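/- Let $\mathscr{H}$ be a complex Hilbert space. A quantum walk on $\mathscr{H}$ is given by a unitary operator $U$ on $\mathscr{H}$, and its states are the unit vectors of $\mathscr{H}$. For a closed subspace $\mathscr{K}\subset\mathscr{H}$ with orthogonal projection $P$ and $Q=1-P$, and a state $\psi\in\mathscr{K}$, the return probability of $\psi$ to $\mathscr{K}$ is $$\pi(\psi\to\mathscr{K})=\sum_{n\ge1}\|PU(QU)^{n-1}P\psi\|^2 .$$ The state $\psi\in\mathscr{K}$ is $\mathscr{K}$-recurrent for $U$ if $\pi(\psi\to\mathscr{K})=1$; the subspace $\mathscr{K}$ is recurrent for $U$ if every state of $\mathscr{K}$ is $\mathscr{K}$-recurrent for $U$; and a state $\psi$ is recurrent for $U$ if it is $\operatorname{span}\{\psi\}$-recurrent for $U$. Theorem (splitting rules for QW recurrence). Let $\mathscr{H}=\mathscr{H}_-\oplus\mathscr{H}_0\oplus\mathscr{H}_+$ be an orthogonal decomposition of $\mathscr{H}$ into closed subspaces, let $U_L$ and $U_R$ be unitary operators on $\mathscr{H}_L=\mathscr{H}_-\oplus\mathscr{H}_0$ and $\mathscr{H}_R=\mathscr{H}_0\oplus\mathscr{H}_+$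 respectively, and let $U=(U_L\oplus 1_+)(1_-\oplus U_R)$, where $1_\pm$ is the identity on $\mathscr{H}_\pm$. Then, for every state $\psi\in\mathscr{H}_0$: 1. If $\mathscr{H}_0$ is recurrent for $U_L$ and $\psi$ is $\mathscr{H}_0$-recurrent for $U_R$, then $\psi$ is $\mathscr{H}_0$-recurrent for $U$. 2. If $\psi$ is $\mathscr{H}_0$-recurrent for $U$, then $\psi$ is $\mathscr{H}_0$-recurrent for $U_R$. 3. If $\mathscr{H}_0=\operatorname{span}\{\psi\}$, then $\psi$ is recurrent for $U$ if and only if $\psi$ is recurrent for both $U_L$ and $U_R$. -/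

import Mathlib

/-! ### Monitored recurrence of quantum walks

A quantum walk on a complex Hilbert space `H` is given by a unitary operator, that is, by a
surjective linear isometry `U : H ≃ₗᵢ[ℂ] H`.  States are unit vectors. -/

namespace QW

open scoped ENNReal

section Recurrence

variable {H : Type*} [NormedAddCommGroup H] [InnerProductSpace ℂ H]

/-- The unitary `U` as a bounded operator. -/
noncomputable def toOp (U : H ≃ₗᵢ[ℂ] H) : H →L[ℂ] H :=
  U.toLinearIsometry.toContinuousLinearMap

/-- The first time return amplitude `a_n = P U (Q U)^{n-1} P`, for `n ≥ 1`, where `P` is the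
orthogonal projection onto `K` and `Q = 1 - P`. -/
noncomputable def firstReturnAmplitude (U : H ≃ₗᵢ[ℂ] H) (K : Submodule ℂ H)
    [K.HasOrthogonalProjection] (n : ℕ) : H →L[ℂ] H :=
  K.starProjection * toOp U * ((1 - K.starProjection) * toOp U) ^ (n - 1) * K.starProjection

/-- The probability `π_n(ψ → K) = ‖a_n ψ‖²` of returning to `K` for the first time in `n ≥ 1`
steps when starting at the state `ψ ∈ K`. -/
noncomputable def firstReturnProb (U : H ≃ₗᵢ[ℂ] H) (K : Submodule ℂ H)
    [K.HasOrthogonalProjection] (n : ℕ) (ψ : H) : ℝ≥0∞ :=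
  ENNReal.ofReal (‖firstReturnAmplitude U K n ψ‖ ^ 2)

/-- The return probability `π(ψ → K) = ∑_{n ≥ 1} π_n(ψ → K)`, for a state `ψ ∈ K`. -/
noncomputable def returnProb (U : H ≃ₗᵢ[ℂ] H) (K : Submodule ℂ H)
    [K.HasOrthogonalProjection] (ψ : H) : ℝ≥0∞ :=
  ∑' n : ℕ, firstReturnProb U K (n + 1) ψ

/-- The state `ψ ∈ K` is `K`-recurrent. -/
def IsRecurrentIn (U : H ≃ₗᵢ[ℂ] H) (K : Submodule ℂ H) [K.HasOrthogonalProjection]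
    (ψ : H) : Prop :=
  returnProb U K ψ = 1

/-- The state `ψ` is recurrent: it is recurrent in the line `span {ψ}`. -/
def IsRecurrentState (U : H ≃ₗᵢ[ℂ] H) (ψ : H) : Prop :=
  returnProb U (Submodule.span ℂ {ψ}) ψ = 1

/-- The closed subspace `K` is recurrent: all its states are `K`-recurrent. -/
def IsRecurrentSubspace (U : H ≃ₗᵢ[ℂ] H) (K : Submodule ℂ H)
    [K.HasOrthogonalProjection] : Prop :=
  ∀ φ ∈ K, ‖φ‖ = 1 → IsRecurrentIn U K φ

/-- For a unitary `V` on a closed subspace `L`, the unitary `V ⊕ 1` on `H = L ⊕ Lᗮ`. -/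
noncomputable def sumId (L : Submodule ℂ H) [L.HasOrthogonalProjection] (V : L ≃ₗᵢ[ℂ] L) :
    H ≃ₗᵢ[ℂ] H :=
  (L.orthogonalDecomposition.trans
    (LinearIsometryEquiv.withLpProdCongr 2 V (LinearIsometryEquiv.refl ℂ Lᗮ))).trans
    L.orthogonalDecomposition.symm

theorem sumId_apply (L : Submodule ℂ H) [L.HasOrthogonalProjection] (V : L ≃ₗᵢ[ℂ] L)
    (x : L) (y : Lᗮ) : sumId L V ((x : H) + (y : H)) = (V x : H) + (y : H) := by
  have h : L.orthogonalDecomposition ((x : H) + (y : H)) = WithLp.toLp 2 (x, y) := by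
    apply L.orthogonalDecomposition.symm.injective
    have h0 : L.starProjection (y : H) = 0 :=
      (Submodule.starProjection_apply_eq_zero_iff L).mpr y.2
    simp [h0]
  simp only [sumId, LinearIsometryEquiv.trans_apply, h]
  simp [LinearIsometryEquiv.withLpProdCongr]

end Recurrence

/-- An orthogonal decomposition `H = H₋ ⊕ H₀ ⊕ H₊` into closed subspaces. -/
structure OrthogonalSplitting (H : Type*) [NormedAddCommGroup H] [InnerProductSpace ℂ H] where
  minus : Submodule ℂ H
  zero : Submodule ℂ H
  plus : Submodule ℂ H
  isClosed_minus : IsClosed (minus : Set H)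
  isClosed_zero : IsClosed (zero : Set H)
  isClosed_plus : IsClosed (plus : Set H)
  minus_zero : minus ⟂ zero
  minus_plus : minus ⟂ plus
  zero_plus : zero ⟂ plus
  sup_eq_top : minus ⊔ zero ⊔ plus = ⊤

namespace OrthogonalSplitting

variable {H : Type*} [NormedAddCommGroup H] [InnerProductSpace ℂ H]
  (D : OrthogonalSplitting H)

/-- `H_L = H₋ ⊕ H₀`. -/
def left : Submodule ℂ H := D.minus ⊔ D.zero

/-- `H_R = H₀ ⊕ H₊`. -/
def right : Submodule ℂ H := D.zero ⊔ D.plus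

/-- `H₀` as a subspace of `H_L`. -/
def zeroLeft : Submodule ℂ D.left := D.zero.comap D.left.subtype

/-- `H₀` as a subspace of `H_R`. -/
def zeroRight : Submodule ℂ D.right := D.zero.comap D.right.subtype

theorem zero_le_left : D.zero ≤ D.left := le_sup_right

theorem zero_le_right : D.zero ≤ D.right := le_sup_left

/-- A vector of `H₀` seen in `H_L`. -/
def inLeft (ψ : D.zero) : D.left := ⟨ψ, D.zero_le_left ψ.2⟩

/-- A vector of `H₀` seen in `H_R`. -/
def inRight (ψ : D.zero) : D.right := ⟨ψ, D.zero_le_right ψ.2⟩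

theorem eq_orthogonal {A B : Submodule ℂ H} (h : A ⟂ B) (ht : A ⊔ B = ⊤) : A = Bᗮ := by
  refine le_antisymm h fun x hx => ?_
  obtain ⟨a, ha, b, hb, rfl⟩ := Submodule.mem_sup.mp (ht ▸ Submodule.mem_top (x := x))
  have hb' : b ∈ Bᗮ := by simpa using Bᗮ.sub_mem hx (h ha)
  have h0 : b = 0 := inner_self_eq_zero.mp (hb' b hb)
  simpa [h0] using ha

theorem left_eq : D.left = D.plusᗮ :=
  eq_orthogonal (Submodule.isOrtho_sup_left.mpr ⟨D.minus_plus, D.zero_plus⟩) D.sup_eq_top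

theorem right_eq : D.right = D.minusᗮ :=
  eq_orthogonal (Submodule.isOrtho_sup_left.mpr ⟨D.minus_zero.symm, D.minus_plus.symm⟩)
    (by rw [sup_comm]; unfold right; rw [← sup_assoc]; exact D.sup_eq_top)

/-- The complement on which `U_L ⊕ 1₊` acts as the identity is `H₊`. -/
theorem left_orthogonal : D.leftᗮ = D.plus :=
  (eq_orthogonal (Submodule.isOrtho_sup_right.mpr ⟨D.minus_plus.symm, D.zero_plus.symm⟩)
    (by rw [sup_comm]; exact D.sup_eq_top)).symm

/-- The complement on which `1₋ ⊕ U_R` acts as the identity is `H₋`. -/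
theorem right_orthogonal : D.rightᗮ = D.minus :=
  (eq_orthogonal (Submodule.isOrtho_sup_right.mpr ⟨D.minus_zero, D.minus_plus⟩)
    (by rw [← sup_assoc]; exact D.sup_eq_top)).symm

variable [CompleteSpace H]

instance : CompleteSpace D.zero := D.isClosed_zero.completeSpace_coe

instance : CompleteSpace D.left := by
  rw [left_eq]; infer_instance

instance : CompleteSpace D.right := by
  rw [right_eq]; infer_instance

instance : CompleteSpace D.zeroLeft :=
  (D.isClosed_zero.preimage continuous_subtype_val).completeSpace_coe

instance : CompleteSpace D.zeroRight :=
  (D.isClosed_zero.preimage continuous_subtype_val).completeSpace_coe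

/-- The unitary `U = (U_L ⊕ 1₊)(1₋ ⊕ U_R)` on `H`. -/
noncomputable def overlap (UL : D.left ≃ₗᵢ[ℂ] D.left) (UR : D.right ≃ₗᵢ[ℂ] D.right) :
    H ≃ₗᵢ[ℂ] H :=
  sumId D.left UL * sumId D.right UR

theorem overlap_apply (UL : D.left ≃ₗᵢ[ℂ] D.left) (UR : D.right ≃ₗᵢ[ℂ] D.right) (x : H) :
    D.overlap UL UR x = sumId D.left UL (sumId D.right UR x) := rfl

end OrthogonalSplitting

end QW

namespace QW

open Filter Topology

/-! ### Recurrence as decay of the survival amplitude. -/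

section Survival

variable {H : Type*} [NormedAddCommGroup H] [InnerProductSpace ℂ H]

/-! Return probabilities telescope, so a unit vector of `K` is recurrent exactly when its survival
amplitude `(QU)^n ψ` tends to zero (`isRecurrentIn_iff_tendsto`). Let `A = U_L ⊕ 1`, `B = 1 ⊕ U_R`.
The survival amplitude for `AB` is that for `B`, orthogonal to `H₋`, plus a part `m_n` in `H₋`. If
`r_n` is the amplitude in `H₀` that `B` returns at time `n + 1`, then `m_{n+1} = QA(m_n + r_n)`
(`minusPart_mem_and_succ`). Orthogonality gives statement 2. For statement 1, restart at a late time
`M`: the old part `(QA)^k m_M` dies by recurrence for `U_L`, and the later inputs have total squared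
norm at most the survival probability for `B` at time `M`. For statement 3, return amplitudes to a
line are scalars that inversion conjugates; since `(AB)⁻¹ = B⁻¹A⁻¹`, statement 2 with `H₋` and `H₊`
exchanged handles `U_L`. -/

@[simp]
theorem toOp_apply (U : H ≃ₗᵢ[ℂ] H) (x : H) : toOp U x = U x := rfl

/-- The monitored evolution `Q U`, where `Q = 1 - P` and `P` is the projection onto `K`. -/
noncomputable def survivalOp (U : H ≃ₗᵢ[ℂ] H) (K : Submodule ℂ H)
    [K.HasOrthogonalProjection] : H →L[ℂ] H :=
  (1 - K.starProjection) * toOp U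

theorem survivalOp_apply (U : H ≃ₗᵢ[ℂ] H) (K : Submodule ℂ H) [K.HasOrthogonalProjection]
    (x : H) : survivalOp U K x = U x - K.starProjection (U x) := rfl

theorem survivalOp_pow_succ_apply (U : H ≃ₗᵢ[ℂ] H) (K : Submodule ℂ H)
    [K.HasOrthogonalProjection] (n : ℕ) (x : H) :
    (survivalOp U K ^ (n + 1)) x = survivalOp U K ((survivalOp U K ^ n) x) := by
  rw [pow_succ']; rfl

theorem norm_sq_starProjection_add_survivalOp (U : H ≃ₗᵢ[ℂ] H) (K : Submodule ℂ H)
    [K.HasOrthogonalProjection] (x : H) :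
    ‖K.starProjection (U x)‖ ^ 2 + ‖survivalOp U K x‖ ^ 2 = ‖x‖ ^ 2 := by
  have h := K.norm_sq_eq_add_norm_sq_starProjection (U x)
  rw [K.starProjection_orthogonal_val, U.norm_map] at h
  exact h.symm

theorem norm_survivalOp_le (U : H ≃ₗᵢ[ℂ] H) (K : Submodule ℂ H)
    [K.HasOrthogonalProjection] (x : H) : ‖survivalOp U K x‖ ≤ ‖x‖ := by
  have h := norm_sq_starProjection_add_survivalOp U K x
  refine le_of_sq_le_sq ?_ (norm_nonneg _)
  nlinarith [sq_nonneg ‖K.starProjection (U x)‖]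

theorem antitone_norm_survivalOp_pow (U : H ≃ₗᵢ[ℂ] H) (K : Submodule ℂ H)
    [K.HasOrthogonalProjection] (x : H) : Antitone fun n => ‖(survivalOp U K ^ n) x‖ :=
  antitone_nat_of_succ_le fun n => by
    rw [survivalOp_pow_succ_apply]; exact norm_survivalOp_le U K _

theorem firstReturnAmplitude_succ_apply (U : H ≃ₗᵢ[ℂ] H) (K : Submodule ℂ H)
    [K.HasOrthogonalProjection] (n : ℕ) {ψ : H} (hψ : ψ ∈ K) :
    firstReturnAmplitude U K (n + 1) ψ = K.starProjection (U ((survivalOp U K ^ n) ψ)) := by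
  have h : K.starProjection ψ = ψ := K.starProjection_eq_self_iff.mpr hψ
  simp [firstReturnAmplitude, survivalOp, h]

/-- The first return probabilities are the successive losses of the survival probability. -/
theorem firstReturnProb_succ (U : H ≃ₗᵢ[ℂ] H) (K : Submodule ℂ H)
    [K.HasOrthogonalProjection] (n : ℕ) {ψ : H} (hψ : ψ ∈ K) :
    firstReturnProb U K (n + 1) ψ =
      ENNReal.ofReal (‖(survivalOp U K ^ n) ψ‖ ^ 2 - ‖(survivalOp U K ^ (n + 1)) ψ‖ ^ 2) := by
  rw [firstReturnProb, firstReturnAmplitude_succ_apply U K n hψ, survivalOp_pow_succ_apply,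
    ← norm_sq_starProjection_add_survivalOp U K ((survivalOp U K ^ n) ψ), add_sub_cancel_right]

/-- A state is recurrent if and only if its survival amplitude tends to zero. -/
theorem isRecurrentIn_iff_tendsto (U : H ≃ₗᵢ[ℂ] H) (K : Submodule ℂ H)
    [K.HasOrthogonalProjection] {ψ : H} (hψ : ψ ∈ K) (h1 : ‖ψ‖ = 1) :
    IsRecurrentIn U K ψ ↔ Tendsto (fun n => (survivalOp U K ^ n) ψ) atTop (𝓝 0) := by
  set e : ℕ → ℝ := fun n => ‖(survivalOp U K ^ n) ψ‖ ^ 2 with he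
  have e0 : e 0 = 1 := by simp [he, h1]
  have hanti : Antitone e := fun m n hmn =>
    pow_le_pow_left₀ (norm_nonneg _) (antitone_norm_survivalOp_pow U K ψ hmn) 2
  have hpart (n : ℕ) :
      ∑ i ∈ Finset.range n, firstReturnProb U K (i + 1) ψ = ENNReal.ofReal (1 - e n) := by
    simp_rw [firstReturnProb_succ U K _ hψ]
    -- Monotonicity of `e` makes the differences nonnegative, so the sum can telescope in `ℝ`.
    rw [← ENNReal.ofReal_sum_of_nonneg fun i _ => sub_nonneg.mpr (hanti i.le_succ),
      Finset.sum_range_sub' e n, e0]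
  have hsum : Tendsto (fun n => ENNReal.ofReal (1 - e n)) atTop (𝓝 (returnProb U K ψ)) := by
    simp_rw [← hpart]
    exact ENNReal.tendsto_nat_tsum _
  have hiff : Tendsto (fun n => (survivalOp U K ^ n) ψ) atTop (𝓝 0) ↔ Tendsto e atTop (𝓝 0) := by
    rw [tendsto_zero_iff_norm_tendsto_zero]
    refine ⟨fun h => by simpa [he] using h.pow 2, fun h => ?_⟩
    simpa [he, Real.sqrt_sq (norm_nonneg _)] using h.sqrt
  rw [hiff, IsRecurrentIn]
  constructor
  · intro h
    rw [h] at hsum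
    have h2 := (ENNReal.tendsto_toReal ENNReal.one_ne_top).comp hsum
    have h3 (n : ℕ) : (ENNReal.ofReal (1 - e n)).toReal = 1 - e n :=
      ENNReal.toReal_ofReal (sub_nonneg.mpr (e0 ▸ hanti n.zero_le))
    simp only [Function.comp_def, h3, ENNReal.toReal_one] at h2
    simpa using h2.const_sub 1
  · intro h
    have h2 := ENNReal.tendsto_ofReal (h.const_sub 1)
    rw [sub_zero, ENNReal.ofReal_one] at h2
    exact tendsto_nhds_unique hsum h2

theorem IsRecurrentSubspace.tendsto {U : H ≃ₗᵢ[ℂ] H} {K : Submodule ℂ H}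
    [K.HasOrthogonalProjection] (h : IsRecurrentSubspace U K) {φ : H} (hφ : φ ∈ K) :
    Tendsto (fun n => (survivalOp U K ^ n) φ) atTop (𝓝 0) := by
  rcases eq_or_ne φ 0 with rfl | h0
  · simp
  have hn : (‖φ‖ : ℂ) ≠ 0 := by simpa using h0
  have hmem : (‖φ‖ : ℂ)⁻¹ • φ ∈ K := K.smul_mem _ hφ
  have hone : ‖(‖φ‖ : ℂ)⁻¹ • φ‖ = 1 := by
    rw [norm_smul, norm_inv, Complex.norm_real, norm_norm,
      inv_mul_cancel₀ (norm_ne_zero_iff.mpr h0)]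
  have ht := ((isRecurrentIn_iff_tendsto U K hmem hone).mp (h _ hmem hone)).const_smul (‖φ‖ : ℂ)
  simpa [smul_smul, hn] using ht

theorem isRecurrentIn_congr (U : H ≃ₗᵢ[ℂ] H) {K K' : Submodule ℂ H}
    [K.HasOrthogonalProjection] [K'.HasOrthogonalProjection] (h : K = K') (ψ : H) :
    IsRecurrentIn U K ψ ↔ IsRecurrentIn U K' ψ := by
  subst h; rfl

theorem norm_apply_of_mem_span_singleton {ψ x : H} (h1 : ‖ψ‖ = 1)
    (hx : x ∈ Submodule.span ℂ {ψ}) : ‖x‖ = ‖(inner ℂ ψ x : ℂ)‖ := by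
  obtain ⟨c, rfl⟩ := Submodule.mem_span_singleton.mp hx
  simp [norm_smul, h1, inner_self_eq_norm_sq_to_K]

theorem firstReturnAmplitude_apply_mem (U : H ≃ₗᵢ[ℂ] H) (K : Submodule ℂ H)
    [K.HasOrthogonalProjection] (n : ℕ) (x : H) : firstReturnAmplitude U K n x ∈ K :=
  K.starProjection_apply_mem _

theorem map_mem_orthogonal {A : H ≃ₗᵢ[ℂ] H} {M : Submodule ℂ H} (hA : ∀ y ∈ M, A y = y) {x : H}
    (hx : x ∈ Mᗮ) : A x ∈ Mᗮ := fun y hy => by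
  rw [← hA y hy, A.inner_map_map]; exact hx y hy

end Survival

/-! ### Extending a unitary by the identity. -/

section Extension

variable {H : Type*} [NormedAddCommGroup H] [InnerProductSpace ℂ H]

theorem sumId_apply_mem (L : Submodule ℂ H) [L.HasOrthogonalProjection] (V : L ≃ₗᵢ[ℂ] L)
    (x : L) : sumId L V (x : H) = V x := by
  simpa using sumId_apply L V x 0

theorem sumId_apply_orthogonal (L : Submodule ℂ H) [L.HasOrthogonalProjection] (V : L ≃ₗᵢ[ℂ] L)
    {y : H} (hy : y ∈ Lᗮ) : sumId L V y = y := by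
  simpa using sumId_apply L V 0 ⟨y, hy⟩

theorem coe_starProjection_comap_subtype {L K : Submodule ℂ H} (hKL : K ≤ L)
    [K.HasOrthogonalProjection] [(K.comap L.subtype).HasOrthogonalProjection] (x : L) :
    (((K.comap L.subtype).starProjection x : L) : H) = K.starProjection (x : H) := by
  refine (Submodule.eq_starProjection_of_mem_of_inner_eq_zero ?_ ?_).symm
  · exact (K.comap L.subtype).starProjection_apply_mem x
  · intro w hw
    exact (K.comap L.subtype).starProjection_inner_eq_zero x ⟨w, hKL hw⟩ hw

/-- `L` is invariant under `V ⊕ 1` and, since it contains `K`, under the projection onto `K`; the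
monitored evolution never leaves `L`. -/
theorem coe_survivalOp_pow {L K : Submodule ℂ H} (hKL : K ≤ L) [L.HasOrthogonalProjection]
    [K.HasOrthogonalProjection] [(K.comap L.subtype).HasOrthogonalProjection]
    (V : L ≃ₗᵢ[ℂ] L) (x : L) (n : ℕ) :
    (((survivalOp V (K.comap L.subtype) ^ n) x : L) : H) =
      (survivalOp (sumId L V) K ^ n) (x : H) := by
  induction n with
  | zero => simp
  | succ n ih =>
    rw [survivalOp_pow_succ_apply, survivalOp_pow_succ_apply, ← ih, survivalOp_apply,
      survivalOp_apply, sumId_apply_mem, ← coe_starProjection_comap_subtype hKL]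
    rfl

theorem tendsto_survivalOp_sumId_iff {L K : Submodule ℂ H} (hKL : K ≤ L)
    [L.HasOrthogonalProjection] [K.HasOrthogonalProjection]
    [(K.comap L.subtype).HasOrthogonalProjection] (V : L ≃ₗᵢ[ℂ] L) (x : L) :
    Tendsto (fun n => (survivalOp V (K.comap L.subtype) ^ n) x) atTop (𝓝 0) ↔
      Tendsto (fun n => (survivalOp (sumId L V) K ^ n) (x : H)) atTop (𝓝 0) := by
  simp_rw [← coe_survivalOp_pow hKL V x]
  exact tendsto_subtype_rng

/-- Extending a unitary by the identity does not change recurrence. -/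
theorem isRecurrentIn_sumId_iff {L K : Submodule ℂ H} (hKL : K ≤ L)
    [L.HasOrthogonalProjection] [K.HasOrthogonalProjection]
    [(K.comap L.subtype).HasOrthogonalProjection] (V : L ≃ₗᵢ[ℂ] L) {x : L} (hx : (x : H) ∈ K)
    (h1 : ‖x‖ = 1) :
    IsRecurrentIn V (K.comap L.subtype) x ↔ IsRecurrentIn (sumId L V) K (x : H) := by
  rw [isRecurrentIn_iff_tendsto V (K.comap L.subtype) hx h1,
    isRecurrentIn_iff_tendsto (sumId L V) K hx h1, tendsto_survivalOp_sumId_iff hKL]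

end Extension

/-! ### Time reversal. -/

section Adjoint

variable {H : Type*} [NormedAddCommGroup H] [InnerProductSpace ℂ H] [CompleteSpace H]

theorem star_toOp (U : H ≃ₗᵢ[ℂ] H) : star (toOp U) = toOp U.symm := by
  rw [ContinuousLinearMap.star_eq_adjoint, eq_comm, ContinuousLinearMap.eq_adjoint_iff]
  intro x y
  rw [toOp_apply, toOp_apply, ← U.inner_map_map, U.apply_symm_apply]

/-- Taking adjoints reverses the word `P U (Q U) ⋯ (Q U) P`, which is a palindrome in `P`, `Q`, `U`.
-/
theorem star_firstReturnAmplitude (U : H ≃ₗᵢ[ℂ] H) (K : Submodule ℂ H)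
    [K.HasOrthogonalProjection] (n : ℕ) :
    star (firstReturnAmplitude U K n) = firstReturnAmplitude U.symm K n := by
  have hP : star K.starProjection = K.starProjection := isSelfAdjoint_starProjection K
  have hQ : star (1 - K.starProjection) = 1 - K.starProjection := by rw [star_sub, star_one, hP]
  simp only [firstReturnAmplitude, star_mul, star_pow, hP, hQ, star_toOp, mul_assoc]
  congr 1
  generalize 1 - K.starProjection = Q
  have h : SemiconjBy (toOp U.symm) (Q * toOp U.symm) (toOp U.symm * Q) :=
    (mul_assoc _ _ _).symm
  rw [← mul_assoc, ← mul_assoc, (h.pow_right (n - 1)).eq]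

/-- A state has the same return probability for a unitary and for its inverse. -/
theorem returnProb_symm (U : H ≃ₗᵢ[ℂ] H) {ψ : H} (h1 : ‖ψ‖ = 1) :
    returnProb U.symm (Submodule.span ℂ {ψ}) ψ = returnProb U (Submodule.span ℂ {ψ}) ψ := by
  unfold returnProb firstReturnProb
  congr 1
  ext n
  rw [norm_apply_of_mem_span_singleton h1 (firstReturnAmplitude_apply_mem U.symm _ _ _),
    norm_apply_of_mem_span_singleton h1 (firstReturnAmplitude_apply_mem U _ _ _),
    ← star_firstReturnAmplitude, ContinuousLinearMap.star_eq_adjoint,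
    ContinuousLinearMap.adjoint_inner_right, norm_inner_symm]

end Adjoint

/-! ### Monitored evolution for overlapping unitaries. -/

namespace OrthogonalSplitting

variable {H : Type*} [NormedAddCommGroup H] [InnerProductSpace ℂ H]

/-- The splitting with the roles of `H₋` and `H₊` exchanged. -/
def swap (D : OrthogonalSplitting H) : OrthogonalSplitting H where
  minus := D.plus
  zero := D.zero
  plus := D.minus
  isClosed_minus := D.isClosed_plus
  isClosed_zero := D.isClosed_zero
  isClosed_plus := D.isClosed_minus
  minus_zero := D.zero_plus.symm
  minus_plus := D.minus_plus.symm
  zero_plus := D.minus_zero.symm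
  sup_eq_top := by rw [sup_comm, sup_comm D.plus, ← sup_assoc]; exact D.sup_eq_top

variable [CompleteSpace H] (D : OrthogonalSplitting H)

theorem sub_starProjection_mem_plus {x : H} (hx : x ∈ D.minusᗮ) :
    x - D.zero.starProjection x ∈ D.plus := by
  rw [← D.right_eq] at hx
  obtain ⟨z, hz, p, hp, rfl⟩ := Submodule.mem_sup.mp hx
  have h1 : D.zero.starProjection z = z := D.zero.starProjection_eq_self_iff.mpr hz
  have h2 : D.zero.starProjection p = 0 :=
    (Submodule.starProjection_apply_eq_zero_iff D.zero).mpr (D.zero_plus.symm hp)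
  simpa [h1, h2] using hp

theorem sub_starProjection_mem_minus {x : H} (hx : x ∈ D.plusᗮ) :
    x - D.zero.starProjection x ∈ D.minus :=
  D.swap.sub_starProjection_mem_plus hx

variable {D} {A B : H ≃ₗᵢ[ℂ] H}

theorem survivalOp_mem_plus (hB : ∀ y ∈ D.minus, B y = y) {x : H} (hx : x ∈ D.minusᗮ) :
    survivalOp B D.zero x ∈ D.plus :=
  D.sub_starProjection_mem_plus (map_mem_orthogonal hB hx)

theorem survivalOp_mem_minus (hA : ∀ y ∈ D.plus, A y = y) {x : H} (hx : x ∈ D.plusᗮ) :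
    survivalOp A D.zero x ∈ D.minus :=
  D.sub_starProjection_mem_minus (map_mem_orthogonal hA hx)

theorem survivalOp_pow_mem_orthogonal_minus (hB : ∀ y ∈ D.minus, B y = y) {ψ : H}
    (hψ : ψ ∈ D.zero) (n : ℕ) : (survivalOp B D.zero ^ n) ψ ∈ D.minusᗮ := by
  induction n with
  | zero => exact D.minus_zero.symm hψ
  | succ n ih =>
    rw [survivalOp_pow_succ_apply]
    exact D.minus_plus.symm (survivalOp_mem_plus hB ih)

theorem survivalOp_eq_self (hA : ∀ y ∈ D.plus, A y = y) {x : H} (hx : x ∈ D.plus) :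
    survivalOp A D.zero x = x := by
  rw [survivalOp_apply, hA x hx,
    (Submodule.starProjection_apply_eq_zero_iff D.zero).mpr (D.zero_plus.symm hx), sub_zero]

/-- The part in `H₋` at time `n` of the monitored evolution by `A B` of the vector `ψ`. -/
noncomputable def minusPart (D : OrthogonalSplitting H) (A B : H ≃ₗᵢ[ℂ] H) (ψ : H) (n : ℕ) : H :=
  (survivalOp (A * B) D.zero ^ n) ψ - (survivalOp B D.zero ^ n) ψ

/-- The amplitude in `H₀` that the monitored evolution by `B` of the vector `ψ` loses at time
`n + 1`. -/
noncomputable def returnPart (D : OrthogonalSplitting H) (B : H ≃ₗᵢ[ℂ] H) (ψ : H) (n : ℕ) : H :=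
  D.zero.starProjection (B ((survivalOp B D.zero ^ n) ψ))

theorem returnPart_mem (ψ : H) (n : ℕ) : D.returnPart B ψ n ∈ D.zero :=
  D.zero.starProjection_apply_mem _

theorem norm_sq_returnPart (ψ : H) (n : ℕ) :
    ‖D.returnPart B ψ n‖ ^ 2 =
      ‖(survivalOp B D.zero ^ n) ψ‖ ^ 2 - ‖(survivalOp B D.zero ^ (n + 1)) ψ‖ ^ 2 := by
  rw [survivalOp_pow_succ_apply, eq_sub_iff_add_eq]
  exact norm_sq_starProjection_add_survivalOp B D.zero _

/-- `B` fixes the minus part and splits its own survival amplitude into a return in `H₀` and a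
remainder in `H₊`. The remainder is untouched by `A` and by the projection, so it cancels in the
difference, leaving `A` to act on the rest. -/
theorem minusPart_mem_and_succ (hA : ∀ y ∈ D.plus, A y = y) (hB : ∀ y ∈ D.minus, B y = y) {ψ : H}
    (hψ : ψ ∈ D.zero) (n : ℕ) :
    D.minusPart A B ψ n ∈ D.minus ∧ D.minusPart A B ψ (n + 1) =
      survivalOp A D.zero (D.minusPart A B ψ n + D.returnPart B ψ n) := by
  have step (n : ℕ) (hn : D.minusPart A B ψ n ∈ D.minus) : D.minusPart A B ψ (n + 1) =
      survivalOp A D.zero (D.minusPart A B ψ n + D.returnPart B ψ n) := by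
    set p := (survivalOp B D.zero ^ n) ψ with hp
    have h1 : (survivalOp (A * B) D.zero ^ n) ψ = D.minusPart A B ψ n + p := by
      rw [minusPart, sub_add_cancel]
    have h2 : survivalOp B D.zero p ∈ D.plus :=
      survivalOp_mem_plus hB (survivalOp_pow_mem_orthogonal_minus hB hψ n)
    have h3 : B p = D.returnPart B ψ n + survivalOp B D.zero p := by
      rw [survivalOp_apply, returnPart, ← hp, add_sub_cancel]
    have h4 (x : H) : survivalOp (A * B) D.zero x = survivalOp A D.zero (B x) := rfl
    rw [minusPart, survivalOp_pow_succ_apply, survivalOp_pow_succ_apply, h1, h4, ← hp,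
      map_add B, hB _ hn, h3, ← add_assoc, map_add _ _ (survivalOp B D.zero p),
      survivalOp_eq_self hA h2, add_sub_cancel_right]
  have mem (n : ℕ) : D.minusPart A B ψ n ∈ D.minus := by
    induction n with
    | zero => simp [minusPart]
    | succ n ih =>
      rw [step n ih]
      exact survivalOp_mem_minus hA (D.plusᗮ.add_mem (D.minus_plus ih)
        (D.zero_plus (returnPart_mem ψ n)))
  exact ⟨mem n, step n (mem n)⟩

/-- If the monitored evolution by `A B` dies out, so does the one by `B`. -/
theorem tendsto_survivalOp_of_mul (hA : ∀ y ∈ D.plus, A y = y) (hB : ∀ y ∈ D.minus, B y = y)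
    {ψ : H} (hψ : ψ ∈ D.zero)
    (h : Tendsto (fun n => (survivalOp (A * B) D.zero ^ n) ψ) atTop (𝓝 0)) :
    Tendsto (fun n => (survivalOp B D.zero ^ n) ψ) atTop (𝓝 0) := by
  refine squeeze_zero_norm (fun n => ?_) (tendsto_zero_iff_norm_tendsto_zero.mp h)
  have hm := (minusPart_mem_and_succ hA hB hψ n).1
  have hp := survivalOp_pow_mem_orthogonal_minus hB hψ n
  have h1 : (survivalOp (A * B) D.zero ^ n) ψ =
      D.minusPart A B ψ n + (survivalOp B D.zero ^ n) ψ := by rw [minusPart, sub_add_cancel]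
  have h2 := norm_add_sq_eq_norm_sq_add_norm_sq_of_inner_eq_zero (𝕜 := ℂ) _ _ (hp _ hm)
  rw [← h1] at h2
  nlinarith [norm_nonneg ((survivalOp (A * B) D.zero ^ n) ψ),
    norm_nonneg ((survivalOp B D.zero ^ n) ψ), mul_self_nonneg ‖D.minusPart A B ψ n‖]

/-- The minus part at time `M + k` is the free evolution of the minus part at time `M`, up to an
error that is controlled by the survival amplitude for `B` at time `M`. -/
theorem norm_minusPart_add_sub_le (hA : ∀ y ∈ D.plus, A y = y) (hB : ∀ y ∈ D.minus, B y = y)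
    {ψ : H} (hψ : ψ ∈ D.zero) (M k : ℕ) :
    ‖D.minusPart A B ψ (M + k) - (survivalOp A D.zero ^ k) (D.minusPart A B ψ M)‖ ≤
      ‖(survivalOp B D.zero ^ M) ψ‖ := by
  set r : ℕ → H := fun k =>
    D.minusPart A B ψ (M + k) - (survivalOp A D.zero ^ k) (D.minusPart A B ψ M) with hr
  have r_succ (k : ℕ) : r (k + 1) = survivalOp A D.zero (r k + D.returnPart B ψ (M + k)) := by
    simp only [hr]
    rw [survivalOp_pow_succ_apply, ← add_assoc, (minusPart_mem_and_succ hA hB hψ (M + k)).2,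
      ← map_sub]
    congr 1
    abel
  have r_mem (k : ℕ) : r k ∈ D.minus := by
    induction k with
    | zero => simp [hr]
    | succ k ih =>
      rw [r_succ]
      exact survivalOp_mem_minus hA (D.plusᗮ.add_mem (D.minus_plus ih)
        (D.zero_plus (returnPart_mem ψ _)))
  -- The error in `H₋` is orthogonal to the new input in `H₀` and `A` contracts, so the squared
  -- error grows by at most the probability that `B` loses in that step.
  have key (k : ℕ) : ‖r k‖ ^ 2 ≤
      ‖(survivalOp B D.zero ^ M) ψ‖ ^ 2 - ‖(survivalOp B D.zero ^ (M + k)) ψ‖ ^ 2 := by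
    induction k with
    | zero => simp [hr]
    | succ k ih =>
      have h1 := pow_le_pow_left₀ (norm_nonneg _)
        (norm_survivalOp_le A D.zero (r k + D.returnPart B ψ (M + k))) 2
      have h2 := norm_add_sq_eq_norm_sq_add_norm_sq_of_inner_eq_zero (𝕜 := ℂ) _ _
        (D.minus_zero.symm (returnPart_mem (B := B) ψ (M + k)) _ (r_mem k))
      have h3 := norm_sq_returnPart (D := D) (B := B) ψ (M + k)
      rw [← r_succ] at h1
      rw [← add_assoc]
      nlinarith
  refine le_of_sq_le_sq ?_ (norm_nonneg _)
  nlinarith [key k, sq_nonneg ‖(survivalOp B D.zero ^ (M + k)) ψ‖]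

/-- The part at time `M` is built from finitely many inputs in `H₀`, each of which dies out under
`A`. -/
theorem tendsto_survivalOp_pow_minusPart (hA : ∀ y ∈ D.plus, A y = y)
    (hB : ∀ y ∈ D.minus, B y = y) {ψ : H} (hψ : ψ ∈ D.zero)
    (hL : ∀ φ ∈ D.zero, Tendsto (fun n => (survivalOp A D.zero ^ n) φ) atTop (𝓝 0)) (M : ℕ) :
    Tendsto (fun k => (survivalOp A D.zero ^ k) (D.minusPart A B ψ M)) atTop (𝓝 0) := by
  induction M with
  | zero => simp [minusPart]
  | succ M ih =>
    have h := ((ih.add (hL _ (returnPart_mem (B := B) ψ M))).comp (tendsto_add_atTop_nat 1))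
    rw [add_zero] at h
    refine h.congr fun k => ?_
    rw [(minusPart_mem_and_succ hA hB hψ M).2, Function.comp_apply, ← map_add, pow_succ]
    rfl

/-- If the monitored evolution by `A` dies out on `H₀` and the one by `B` dies out at `ψ`, then
the one by `A B` dies out at `ψ`. -/
theorem tendsto_survivalOp_mul (hA : ∀ y ∈ D.plus, A y = y) (hB : ∀ y ∈ D.minus, B y = y)
    {ψ : H} (hψ : ψ ∈ D.zero)
    (hL : ∀ φ ∈ D.zero, Tendsto (fun n => (survivalOp A D.zero ^ n) φ) atTop (𝓝 0))
    (hR : Tendsto (fun n => (survivalOp B D.zero ^ n) ψ) atTop (𝓝 0)) :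
    Tendsto (fun n => (survivalOp (A * B) D.zero ^ n) ψ) atTop (𝓝 0) := by
  have hm : Tendsto (D.minusPart A B ψ) atTop (𝓝 0) := by
    rw [Metric.tendsto_atTop] at hR ⊢
    intro ε hε
    -- `M` bounds the effect of all later inputs; only then is `N` chosen, depending on `M`.
    obtain ⟨M, hM⟩ := hR (ε / 2) (half_pos hε)
    obtain ⟨N, hN⟩ := Metric.tendsto_atTop.mp
      (tendsto_survivalOp_pow_minusPart hA hB hψ hL M) (ε / 2) (half_pos hε)
    refine ⟨M + N, fun n hn => ?_⟩
    obtain ⟨k, rfl⟩ := Nat.exists_eq_add_of_le (le_trans (Nat.le_add_right M N) hn)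
    have h1 := norm_minusPart_add_sub_le hA hB hψ M k
    have h2 := hM M le_rfl
    have h3 := hN k (by omega)
    rw [dist_zero_right] at h2 h3 ⊢
    linarith [norm_le_norm_sub_add (D.minusPart A B ψ (M + k))
      ((survivalOp A D.zero ^ k) (D.minusPart A B ψ M))]
  simpa [minusPart] using hm.add hR

/-- If `ψ` spans `H₀` and is recurrent for `A B`, then it is recurrent for `A`. -/
theorem isRecurrentState_of_mul (hA : ∀ y ∈ D.plus, A y = y) (hB : ∀ y ∈ D.minus, B y = y)
    {ψ : H} (h1 : ‖ψ‖ = 1) (hspan : D.zero = Submodule.span ℂ {ψ})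
    (h : IsRecurrentState (A * B) ψ) : IsRecurrentState A ψ := by
  have hψ : ψ ∈ D.zero := hspan ▸ Submodule.mem_span_singleton_self ψ
  have symm_fix {C : H ≃ₗᵢ[ℂ] H} {M : Submodule ℂ H} (hC : ∀ y ∈ M, C y = y) (y : H)
      (hy : y ∈ M) : C.symm y = y := by rw [C.symm_apply_eq, hC y hy]
  rw [IsRecurrentState, ← returnProb_symm _ h1] at h ⊢
  have h' : IsRecurrentIn (B.symm * A.symm) D.zero ψ := (isRecurrentIn_congr _ hspan ψ).mpr h
  refine (isRecurrentIn_congr _ hspan ψ).mp ?_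
  rw [isRecurrentIn_iff_tendsto _ _ hψ h1] at h' ⊢
  -- After inversion the right factor is `A⁻¹`, which fixes `H₊`, the minus space of the swapped
  -- splitting.
  exact tendsto_survivalOp_of_mul (D := D.swap) (symm_fix hB) (symm_fix hA) hψ h'

end OrthogonalSplitting

end QW

theorem mainTheorem9 {H : Type*} [NormedAddCommGroup H] [InnerProductSpace ℂ H]
    [CompleteSpace H] (D : QW.OrthogonalSplitting H)
    (UL : D.left ≃ₗᵢ[ℂ] D.left) (UR : D.right ≃ₗᵢ[ℂ] D.right)
    (ψ : D.zero) (hψ : ‖ψ‖ = 1) :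
    (QW.IsRecurrentSubspace UL D.zeroLeft →
      QW.IsRecurrentIn UR D.zeroRight (D.inRight ψ) →
      QW.IsRecurrentIn (D.overlap UL UR) D.zero (ψ : H)) ∧
    (QW.IsRecurrentIn (D.overlap UL UR) D.zero (ψ : H) →
      QW.IsRecurrentIn UR D.zeroRight (D.inRight ψ)) ∧
    (D.zero = Submodule.span ℂ {(ψ : H)} →
      (QW.IsRecurrentState (D.overlap UL UR) (ψ : H) ↔
        QW.IsRecurrentState UL (D.inLeft ψ) ∧ QW.IsRecurrentState UR (D.inRight ψ))) := by
  have : (D.zero.comap D.left.subtype).HasOrthogonalProjection :=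
    inferInstanceAs D.zeroLeft.HasOrthogonalProjection
  have : (D.zero.comap D.right.subtype).HasOrthogonalProjection :=
    inferInstanceAs D.zeroRight.HasOrthogonalProjection
  have h1 : ‖(ψ : H)‖ = 1 := hψ
  have hmem : (ψ : H) ∈ D.zero := ψ.2
  have hA : ∀ y ∈ D.plus, QW.sumId D.left UL y = y := fun y hy =>
    QW.sumId_apply_orthogonal D.left UL (D.left_orthogonal.symm ▸ hy)
  have hB : ∀ y ∈ D.minus, QW.sumId D.right UR y = y := fun y hy =>
    QW.sumId_apply_orthogonal D.right UR (D.right_orthogonal.symm ▸ hy)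
  have hUL : QW.IsRecurrentIn UL D.zeroLeft (D.inLeft ψ) ↔
      QW.IsRecurrentIn (QW.sumId D.left UL) D.zero (ψ : H) :=
    QW.isRecurrentIn_sumId_iff D.zero_le_left UL (x := D.inLeft ψ) hmem h1
  have hUR : QW.IsRecurrentIn UR D.zeroRight (D.inRight ψ) ↔
      QW.IsRecurrentIn (QW.sumId D.right UR) D.zero (ψ : H) :=
    QW.isRecurrentIn_sumId_iff D.zero_le_right UR (x := D.inRight ψ) hmem h1
  have part1 : QW.IsRecurrentSubspace UL D.zeroLeft →
      QW.IsRecurrentIn UR D.zeroRight (D.inRight ψ) →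
      QW.IsRecurrentIn (D.overlap UL UR) D.zero (ψ : H) := by
    intro hL hR
    rw [hUR, QW.isRecurrentIn_iff_tendsto _ _ hmem h1] at hR
    rw [QW.isRecurrentIn_iff_tendsto _ _ hmem h1]
    refine QW.OrthogonalSplitting.tendsto_survivalOp_mul hA hB hmem (fun φ hφ => ?_) hR
    exact (QW.tendsto_survivalOp_sumId_iff D.zero_le_left UL (D.inLeft ⟨φ, hφ⟩)).mp
      (hL.tendsto (φ := D.inLeft ⟨φ, hφ⟩) hφ)
  have part2 : QW.IsRecurrentIn (D.overlap UL UR) D.zero (ψ : H) →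
      QW.IsRecurrentIn UR D.zeroRight (D.inRight ψ) := by
    intro h
    rw [QW.isRecurrentIn_iff_tendsto _ _ hmem h1] at h
    rw [hUR, QW.isRecurrentIn_iff_tendsto _ _ hmem h1]
    exact QW.OrthogonalSplitting.tendsto_survivalOp_of_mul hA hB hmem h
  refine ⟨part1, part2, fun hspan => ?_⟩
  have span_comap {L : Submodule ℂ H} (x : L) (hx : (x : H) = ψ) :
      D.zero.comap L.subtype = Submodule.span ℂ {x} := by
    ext y
    rw [Submodule.mem_comap, hspan, ← hx, Submodule.mem_span_singleton,
      Submodule.mem_span_singleton]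
    simp only [Subtype.ext_iff]
    rfl
  have hSL : QW.IsRecurrentIn UL D.zeroLeft (D.inLeft ψ) ↔
      QW.IsRecurrentState UL (D.inLeft ψ) :=
    QW.isRecurrentIn_congr UL (span_comap (D.inLeft ψ) rfl) _
  have hSR : QW.IsRecurrentIn UR D.zeroRight (D.inRight ψ) ↔
      QW.IsRecurrentState UR (D.inRight ψ) :=
    QW.isRecurrentIn_congr UR (span_comap (D.inRight ψ) rfl) _
  have hS : QW.IsRecurrentIn (D.overlap UL UR) D.zero (ψ : H) ↔
      QW.IsRecurrentState (D.overlap UL UR) (ψ : H) :=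
    QW.isRecurrentIn_congr _ hspan _
  rw [← hSL, ← hSR]
  constructor
  · intro h
    refine ⟨hUL.mpr ((QW.isRecurrentIn_congr _ hspan _).mpr ?_), part2 (hS.mpr h)⟩
    exact QW.OrthogonalSplitting.isRecurrentState_of_mul hA hB h1 hspan h
  · rintro ⟨hL, hR⟩
    refine hS.mp (part1 (fun φ hφ hφ1 => ?_) hR)
    have hφ0 : φ ∈ D.zeroLeft := hφ
    have hspanL : D.zeroLeft = Submodule.span ℂ {D.inLeft ψ} := span_comap (D.inLeft ψ) rfl
    rw [QW.isRecurrentIn_iff_tendsto _ _ hφ0 hφ1]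
    rw [QW.isRecurrentIn_iff_tendsto _ _ (show D.inLeft ψ ∈ D.zeroLeft from hmem) h1] at hL
    -- On a line, decay at `ψ` passes to every multiple, so the whole of `H₀` is recurrent for
    -- `U_L`.
    obtain ⟨c, rfl⟩ := Submodule.mem_span_singleton.mp (hspanL ▸ hφ0)
    simpa using hL.const_smul c
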